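/- Let $X$ be a complex Banach space and let $T$ be a bounded linear operator on $X$. For a closed subspace $L\subseteq X$ with $T(L)\subseteq L$, let $T_L\colon L\to L$ denote the restriction of $T$. For a bounded operator $S$ on a complex Banach space, let $\alpha(S)\in\{0,1,2,\dots\}\cup\{\infty\}$ be the dimension of its kernel and $\beta(S)\in\{0,1,2,\dots\}\cup\{\infty\}$ the codimension of its range. The operator $S$ is called semi-Fredholm if its range is closed and at least one of $\alpha(S),\beta(S)$ is finite, and its index is then $\operatorname{ind}(S)=\alpha(S)-\beta(S)\in\mathbb{Z}\cup\{-\infty,\infty\}$. The operator $S$ is called zeroloid if the spectrum $\sigma(S)$ has no accumulation point other than $0$. Let $(M,N)$ and $(M',N')$ be two pairs of closed $T$-invariant subspaces of $X$ such that $M\cap N=\{0\}$, $M'\cap N'=\{0\}$, and $M\oplus N=M'\oplus N'$ is a closed subspace of $X$. If $T_M$ and $T_{M'}$ are semi-Fredholm and $T_N$ and $T_{N'}$ are zeroloid, then $\operatorname{ind}(T_M)=\operatorname{ind}(T_{M'})$. -/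

import Mathlib

namespace GzFredholm

variable {X : Type*} [NormedAddCommGroup X] [NormedSpace ℂ X]

/-- `α(T)`: the dimension of the kernel of `T`, a natural number or `∞`. -/
noncomputable def alpha (T : X →L[ℂ] X) : ℕ∞ :=
  Cardinal.toENat (Module.rank ℂ (T : X →ₗ[ℂ] X).ker)

/-- `β(T)`: the codimension of the range of `T`, a natural number or `∞`. -/
noncomputable def beta (T : X →L[ℂ] X) : ℕ∞ :=
  Cardinal.toENat (Module.rank ℂ (X ⧸ (T : X →ₗ[ℂ] X).range))

/-- `T` is upper semi-Fredholm: its range is closed and its kernel is finite dimensional. -/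
def IsUpperSemiFredholm (T : X →L[ℂ] X) : Prop :=
  IsClosed (Set.range T) ∧ alpha T < ⊤

/-- `T` is lower semi-Fredholm: its range is closed and has finite codimension. (On a Banach space
a range of finite codimension is automatically closed.) -/
def IsLowerSemiFredholm (T : X →L[ℂ] X) : Prop :=
  IsClosed (Set.range T) ∧ beta T < ⊤

/-- `T` is semi-Fredholm: it is upper or lower semi-Fredholm. -/
def IsSemiFredholm (T : X →L[ℂ] X) : Prop :=
  IsUpperSemiFredholm T ∨ IsLowerSemiFredholm T

/-- The index `ind(T) = α(T) - β(T)` as an element of `ℤ ∪ {-∞, ∞}`, seen inside the extended real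
numbers. It is meant for semi-Fredholm `T`, for which `α(T)` and `β(T)` are not both infinite. -/
noncomputable def index (T : X →L[ℂ] X) : EReal :=
  ((alpha T : ENNReal) : EReal) - ((beta T : ENNReal) : EReal)

/-- `T` is zeroloid: the spectrum of `T` has no accumulation point other than `0`. -/
def IsZeroloid (T : X →L[ℂ] X) : Prop :=
  derivedSet (spectrum ℂ T) ⊆ {0}

end GzFredholm

/-! Off the spectra of `T_N` and `T_{N'}`, the operators `T_M - z` and `T_{M'} - z` both have the
nullity and deficiency of `T - z` on the common sum `M ⊕ N` (`erank_restrict_sup`). Zeroloidity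
supplies such `z` arbitrarily close to `0`, so stability of the index under small shifts finishes
the proof.

Stability comes from bordering: adjoining a finite-dimensional `F` to the domain and `K` to the
codomain makes `S` injective with closed range, or surjective. Both properties survive small
perturbations, and counting dimensions turns them into one-sided index bounds for `S - z`. An
infinite nullity or deficiency is probed by finite-dimensional subspaces of arbitrarily large
dimension. -/

open Filter Topology

namespace GzFredholm

/-! ### Dimension counts for bordered maps and for invariant sums. -/

section Algebra

variable {𝕜 V K : Type*} [Field 𝕜] [AddCommGroup V] [Module 𝕜 V] [AddCommGroup K] [Module 𝕜 K]

/-- The rank of a module as an element of `ℕ∞`. -/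
noncomputable abbrev erank (𝕜 V : Type*) [Field 𝕜] [AddCommGroup V] [Module 𝕜 V] : ℕ∞ :=
  Cardinal.toENat (Module.rank 𝕜 V)

theorem erank_range_add_erank_ker (f : V →ₗ[𝕜] K) :
    erank 𝕜 f.range + erank 𝕜 f.ker = erank 𝕜 V := by
  have h := congrArg Cardinal.toENat (LinearMap.lift_rank_range_add_rank_ker f)
  simpa using h

theorem erank_eq (e : V ≃ₗ[𝕜] K) : erank 𝕜 V = erank 𝕜 K := by
  simpa using congrArg Cardinal.toENat e.lift_rank_eq

theorem erank_le_of_injective (f : V →ₗ[𝕜] K) (hf : Function.Injective f) :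
    erank 𝕜 V ≤ erank 𝕜 K := by
  simpa using Cardinal.toENat.monotone' (LinearMap.lift_rank_le_of_injective f hf)

theorem erank_le_of_surjective (f : V →ₗ[𝕜] K) (hf : Function.Surjective f) :
    erank 𝕜 K ≤ erank 𝕜 V := by
  rw [← erank_range_add_erank_ker f, LinearMap.range_eq_top.2 hf,
    erank_eq (LinearEquiv.ofTop (⊤ : Submodule 𝕜 K) rfl)]
  exact le_self_add

theorem exists_le_erank_eq (W : Submodule 𝕜 V) {n : ℕ} (hn : (n : ℕ∞) ≤ erank 𝕜 W) :
    ∃ G : Submodule 𝕜 V, G ≤ W ∧ erank 𝕜 G = n ∧ FiniteDimensional 𝕜 G := by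
  rw [Cardinal.natCast_le_toENat, Module.le_rank_iff_exists_linearMap] at hn
  obtain ⟨f, hf⟩ := hn
  have hg : Function.Injective (W.subtype ∘ₗ f) := W.injective_subtype.comp hf
  refine ⟨(W.subtype ∘ₗ f).range, ?_, ?_, inferInstance⟩
  · rintro _ ⟨x, rfl⟩
    exact (f x).2
  · rw [← erank_eq (LinearEquiv.ofInjective _ hg)]
    simp

/-- The map `(x, f) ↦ (S x + f, P x)`, bordering `S` by a subspace `F` and a map `P`. -/
def bordered (S : V →ₗ[𝕜] V) (F : Submodule 𝕜 V) (P : V →ₗ[𝕜] K) : V × F →ₗ[𝕜] V × K :=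
  (S.coprod F.subtype).prod (P ∘ₗ LinearMap.fst 𝕜 V F)

variable (S : V →ₗ[𝕜] V) (F : Submodule 𝕜 V)

/-- Project the kernel of `(x, f) ↦ S x + f` to `F`: the image is the part of `F` inside the range
of `S`, and the fibre over `0` is `ker S`. -/
theorem erank_ker_coprod :
    erank 𝕜 (S.coprod F.subtype).ker =
      erank 𝕜 (S.range.mkQ ∘ₗ F.subtype).ker + erank 𝕜 S.ker := by
  let p : (S.coprod F.subtype).ker →ₗ[𝕜] F := LinearMap.snd 𝕜 V F ∘ₗ Submodule.subtype _
  rw [← erank_range_add_erank_ker p]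
  congr 1
  · have : p.range = (S.range.mkQ ∘ₗ F.subtype).ker := by
      ext f
      simp only [LinearMap.mem_range, LinearMap.mem_ker, LinearMap.comp_apply,
        Submodule.mkQ_apply, Submodule.Quotient.mk_eq_zero]
      constructor
      · rintro ⟨⟨⟨x, g⟩, hz⟩, rfl⟩
        refine ⟨-x, ?_⟩
        have hz : S x + g = 0 := hz
        rw [map_neg, neg_eq_iff_add_eq_zero]
        exact hz
      · rintro ⟨x, hx⟩
        refine ⟨⟨(-x, f), ?_⟩, rfl⟩
        simp [hx]
    rw [this]
  · refine (erank_eq (LinearEquiv.ofBijective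
      (LinearMap.codRestrict p.ker (LinearMap.codRestrict (S.coprod F.subtype).ker
        (LinearMap.inl 𝕜 V F ∘ₗ S.ker.subtype) (fun x => by simp)) (fun x => rfl))
      ⟨fun x y h => ?_, ?_⟩)).symm
    · have := congrArg (fun z : p.ker => z.1.1.1) h
      exact Subtype.ext this
    · rintro ⟨⟨⟨x, g⟩, hz⟩, hg⟩
      have hg : g = 0 := hg
      subst hg
      have hz : S x + (0 : F) = 0 := hz
      exact ⟨⟨x, by simpa using hz⟩, rfl⟩

theorem erank_ker_add_erank :
    erank 𝕜 S.ker + erank 𝕜 F =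
      erank 𝕜 (S.coprod F.subtype).ker + erank 𝕜 (S.range.mkQ ∘ₗ F.subtype).range := by
  rw [erank_ker_coprod, ← erank_range_add_erank_ker (S.range.mkQ ∘ₗ F.subtype)]
  ring

variable {S F} {P : V →ₗ[𝕜] K}

/-- On the kernel of `(x, f) ↦ S x + f` only the `P` component remains, so injectivity embeds that
kernel in `K`. -/
theorem erank_le_of_bordered_injective (h : Function.Injective (bordered S F P)) :
    erank 𝕜 S.ker ≤ erank 𝕜 K ∧
      erank 𝕜 S.ker + erank 𝕜 F ≤ erank 𝕜 (V ⧸ S.range) + erank 𝕜 K := by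
  have hR : erank 𝕜 (S.coprod F.subtype).ker ≤ erank 𝕜 K := by
    refine erank_le_of_injective (P ∘ₗ LinearMap.fst 𝕜 V F ∘ₗ Submodule.subtype _) ?_
    rintro ⟨z, hz⟩ ⟨w, hw⟩ hzw
    refine Subtype.ext (h (Prod.ext ?_ hzw))
    exact (LinearMap.mem_ker.1 hz).trans (LinearMap.mem_ker.1 hw).symm
  constructor
  · rw [erank_ker_coprod] at hR
    exact le_add_self.trans hR
  · rw [erank_ker_add_erank, add_comm]
    exact add_le_add (erank_le_of_injective _ (Submodule.injective_subtype _)) hR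

theorem erank_le_of_bordered_surjective (h : Function.Surjective (bordered S F P)) :
    erank 𝕜 (V ⧸ S.range) ≤ erank 𝕜 F ∧
      erank 𝕜 (V ⧸ S.range) + erank 𝕜 K ≤ erank 𝕜 S.ker + erank 𝕜 F := by
  have hR : erank 𝕜 K ≤ erank 𝕜 (S.coprod F.subtype).ker := by
    refine erank_le_of_surjective (P ∘ₗ LinearMap.fst 𝕜 V F ∘ₗ Submodule.subtype _) fun k => ?_
    obtain ⟨z, hz⟩ := h (0, k)
    exact ⟨⟨z, congrArg Prod.fst hz⟩, congrArg Prod.snd hz⟩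
  have hq : Function.Surjective (S.range.mkQ ∘ₗ F.subtype) := fun y => by
    obtain ⟨y, rfl⟩ := Submodule.mkQ_surjective _ y
    obtain ⟨⟨x, f⟩, hz⟩ := h (y, 0)
    refine ⟨f, ?_⟩
    have hz : S x + f = y := congrArg Prod.fst hz
    rw [LinearMap.comp_apply, ← sub_eq_zero, ← map_sub, ← LinearMap.mem_ker, Submodule.ker_mkQ]
    exact ⟨-x, by simp [← hz]⟩
  refine ⟨erank_le_of_surjective _ hq, ?_⟩
  rw [erank_ker_add_erank, LinearMap.range_eq_top.2 hq, add_comm]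
  exact add_le_add hR (erank_eq (LinearEquiv.ofTop _ rfl)).ge

/-- If `f` leaves `M` and `N` invariant and is bijective on `N`, then `M` and `M ⊔ N` see kernels
of the same dimension and ranges of the same codimension. -/
theorem erank_restrict_sup {f : V →ₗ[𝕜] V} {M N : Submodule 𝕜 V} (hM : ∀ x ∈ M, f x ∈ M)
    (hN : ∀ x ∈ N, f x ∈ N) (hMN : M ⊓ N = ⊥) (hY : ∀ x ∈ M ⊔ N, f x ∈ M ⊔ N)
    (hb : Function.Bijective (f.restrict hN)) :
    erank 𝕜 (f.restrict hM).ker = erank 𝕜 (f.restrict hY).ker ∧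
      erank 𝕜 (M ⧸ (f.restrict hM).range) = erank 𝕜 (↥(M ⊔ N) ⧸ (f.restrict hY).range) := by
  -- Since `M ∩ N = 0`, a sum `m + n` lying in `M` has `n = 0`; applied to `f m + f n`, this removes
  -- the `N` component.
  have split : ∀ m ∈ M, ∀ n ∈ N, ∀ m' ∈ M, m + n = m' → n = 0 := fun m hm n hn m' hm' h => by
    have : n ∈ M ⊓ N := ⟨by rw [eq_sub_of_add_eq' h]; exact M.sub_mem hm' hm, hn⟩
    rwa [hMN, Submodule.mem_bot] at this
  let i := Submodule.inclusion (le_sup_left : M ≤ M ⊔ N)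
  constructor
  · refine erank_eq (LinearEquiv.ofBijective
      (LinearMap.codRestrict (f.restrict hY).ker (i ∘ₗ (f.restrict hM).ker.subtype)
        fun x => by
          have hx := congrArg Subtype.val (LinearMap.mem_ker.1 x.2)
          exact Subtype.ext hx)
      ⟨fun x y h => ?_, ?_⟩)
    · exact Subtype.ext (Subtype.ext (congrArg (fun z : (f.restrict hY).ker => (z.1 : V)) h))
    · rintro ⟨⟨y, hy⟩, hfy⟩
      have hfy : f y = 0 := congrArg Subtype.val hfy
      obtain ⟨m, hm, n, hn, rfl⟩ := Submodule.mem_sup.1 hy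
      rw [map_add] at hfy
      have h0 := split _ (hM m hm) _ (hN n hn) 0 M.zero_mem hfy
      have hn0 : (⟨n, hn⟩ : N) = 0 := hb.1 (Subtype.ext (by simpa using h0))
      have hn0 : n = 0 := congrArg Subtype.val hn0
      subst hn0
      refine ⟨⟨⟨m, hm⟩, Subtype.ext ?_⟩, Subtype.ext (Subtype.ext ?_)⟩
      · simpa using hfy
      · exact (add_zero m).symm
  · have hle : (f.restrict hM).range ≤ (f.restrict hY).range.comap i := by
      rintro _ ⟨x, rfl⟩
      exact ⟨i x, rfl⟩
    refine erank_eq (LinearEquiv.ofBijective (Submodule.mapQ _ _ i hle) ⟨?_, ?_⟩)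
    · rw [← LinearMap.ker_eq_bot, Submodule.ker_mapQ, ← le_bot_iff,
        Submodule.map_le_iff_le_comap, ← LinearMap.ker, Submodule.ker_mkQ]
      rintro ⟨x, hx⟩ ⟨⟨y, hy⟩, hxy⟩
      have hxy : f y = x := congrArg Subtype.val hxy
      obtain ⟨m, hm, n, hn, rfl⟩ := Submodule.mem_sup.1 hy
      rw [map_add] at hxy
      have h0 := split _ (hM m hm) _ (hN n hn) x hx hxy
      refine ⟨⟨m, hm⟩, Subtype.ext ?_⟩
      simpa [h0] using hxy
    · intro y
      obtain ⟨⟨y, hy⟩, rfl⟩ := Submodule.mkQ_surjective _ y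
      obtain ⟨m, hm, n, hn, rfl⟩ := Submodule.mem_sup.1 hy
      obtain ⟨⟨k, hk⟩, hkn⟩ := hb.2 ⟨n, hn⟩
      have hkn : f k = n := congrArg Subtype.val hkn
      refine ⟨Submodule.Quotient.mk ⟨m, hm⟩, ?_⟩
      rw [Submodule.mapQ_apply, Submodule.mkQ_apply, Submodule.Quotient.eq]
      refine ⟨-⟨k, (le_sup_right : N ≤ M ⊔ N) hk⟩, Subtype.ext ?_⟩
      simp [i, hkn]

end Algebra

/-! ### Stability of nullity, deficiency and index under small shifts. -/

section Perturbation

variable {E G : Type*} [NormedAddCommGroup E] [NormedSpace ℂ E] [CompleteSpace E]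
  [NormedAddCommGroup G] [NormedSpace ℂ G] [CompleteSpace G]

theorem eventually_injective {A : E →L[ℂ] G} (hA : Function.Injective A)
    (hc : IsClosed (Set.range A)) : ∀ᶠ B : E →L[ℂ] G in 𝓝 A, Function.Injective B := by
  obtain ⟨c, hc⟩ := A.antilipschitz_of_injective_of_isClosed_range hA hc
  -- The constant is enlarged to be positive, so that its inverse is a usable radius.
  replace hc : AntilipschitzWith (c + 1) A := fun x y => (hc x y).trans (by gcongr; simp)
  have hc0 : 0 < c + 1 := by positivity
  filter_upwards [Metric.ball_mem_nhds A (inv_pos.2 (NNReal.coe_pos.2 hc0))] with B hB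
  have hl : LipschitzWith ‖B - A‖₊ (B - A) := (B - A).lipschitz
  have := hc.add_lipschitzWith hl (by
    rw [← NNReal.coe_lt_coe]
    simpa [dist_eq_norm] using hB)
  simpa using this.injective

theorem eventually_surjective {A : E →L[ℂ] G} (hA : Function.Surjective A) :
    ∀ᶠ B : E →L[ℂ] G in 𝓝 A, Function.Surjective B := by
  have hr : A.range = ⊤ := LinearMap.range_eq_top.2 hA
  let s := A.nonlinearRightInverseOfSurjective hr
  have hs : 0 < s.nnnorm := A.nonlinearRightInverseOfSurjective_nnnorm_pos hr
  filter_upwards [Metric.ball_mem_nhds A (inv_pos.2 (NNReal.coe_pos.2 hs))] with B hB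
  have happ : ApproximatesLinearOn B A Set.univ ‖B - A‖₊ := fun x _ y _ => by
    simpa using (B - A).le_opNorm (x - y)
  have hlt : ‖B - A‖₊ < s.nnnorm⁻¹ := by
    rw [← NNReal.coe_lt_coe]
    simpa [dist_eq_norm] using hB
  -- The range of `B` is a subspace that is a neighbourhood of `0`, hence everything.
  have himg := happ.image_mem_nhds s (x := 0) univ_mem (Or.inr hlt)
  rw [Set.image_univ, map_zero] at himg
  have : (B : E →ₗ[ℂ] G).range = ⊤ :=
    Submodule.eq_top_of_nonempty_interior' _ ⟨0, mem_interior_iff_mem_nhds.2 himg⟩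
  exact LinearMap.range_eq_top.1 this

variable {X K : Type*} [NormedAddCommGroup X] [NormedSpace ℂ X] [CompleteSpace X]
  [NormedAddCommGroup K] [NormedSpace ℂ K]

/-- `bordered` for bounded operators. -/
noncomputable def borderedL (S : X →L[ℂ] X) (F : Submodule ℂ X) (P : X →L[ℂ] K) :
    X × F →L[ℂ] X × K :=
  (S.coprod F.subtypeL).prod (P ∘L ContinuousLinearMap.fst ℂ X F)

omit [CompleteSpace X] in
theorem coe_borderedL (S : X →L[ℂ] X) (F : Submodule ℂ X) (P : X →L[ℂ] K) :
    ⇑(borderedL S F P) = bordered (S : X →ₗ[ℂ] X) F (P : X →ₗ[ℂ] K) := rfl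

omit [CompleteSpace X] in
theorem tendsto_borderedL (S : X →L[ℂ] X) (F : Submodule ℂ X) (P : X →L[ℂ] K) :
    Tendsto (fun z : ℂ => borderedL (S - z • 1) F P) (𝓝 0) (𝓝 (borderedL S F P)) := by
  have heq : ∀ z : ℂ, borderedL (S - z • 1) F P = borderedL S F P -
      z • (ContinuousLinearMap.inl ℂ X K ∘L ContinuousLinearMap.fst ℂ X F) := fun z => by
    ext x <;> simp [borderedL]
  simp_rw [heq]
  have : Continuous fun z : ℂ => borderedL S F P -
      z • (ContinuousLinearMap.inl ℂ X K ∘L ContinuousLinearMap.fst ℂ X F) := by fun_prop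
  simpa using this.tendsto 0

/-- Border by `n` dimensions `F` of a complement of the range and by a projection `P` onto the
kernel. For `n = beta S` the second bound says that the index does not increase; if `beta S` is
infinite, `n` is arbitrary. -/
theorem IsUpperSemiFredholm.eventually_le {S : X →L[ℂ] X} (hS : IsUpperSemiFredholm S) {n : ℕ}
    (hn : n ≤ beta S) :
    ∀ᶠ z : ℂ in 𝓝 0, alpha (S - z • 1) ≤ alpha S ∧
      alpha (S - z • 1) + n ≤ beta (S - z • 1) + alpha S := by
  obtain ⟨hc, hfin⟩ := hS
  have : FiniteDimensional ℂ (S : X →ₗ[ℂ] X).ker := by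
    rw [alpha, Cardinal.toENat_lt_top] at hfin
    exact Module.rank_lt_aleph0_iff.1 hfin
  obtain ⟨P, hP⟩ := Submodule.ClosedComplemented.of_finiteDimensional (S : X →ₗ[ℂ] X).ker
  obtain ⟨W, hW⟩ := (S : X →ₗ[ℂ] X).range.exists_isCompl
  obtain ⟨F, hFW, hF, hFfin⟩ := exists_le_erank_eq W
    (hn.trans (erank_eq (Submodule.quotientEquivOfIsCompl _ _ hW)).le)
  have : CompleteSpace F := FiniteDimensional.complete ℂ F
  have : CompleteSpace (S : X →ₗ[ℂ] X).ker := FiniteDimensional.complete ℂ _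
  have hinj : Function.Injective (borderedL S F P) := by
    rw [injective_iff_map_eq_zero]
    rintro ⟨x, f⟩ h
    have h1 : S x + f = 0 := congrArg Prod.fst h
    have h2 : P x = 0 := congrArg Prod.snd h
    have hf : (f : X) = 0 := Submodule.disjoint_def.1 hW.disjoint _
      ⟨-x, by simpa using neg_eq_of_add_eq_zero_right h1⟩ (hFW f.2)
    have hx : S x = 0 := by simpa [hf] using h1
    have hx0 : (⟨x, hx⟩ : (S : X →ₗ[ℂ] X).ker) = 0 := (hP ⟨x, hx⟩).symm.trans h2
    exact Prod.ext (congrArg Subtype.val hx0) (Subtype.ext hf)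
  have hrange : Set.range (borderedL S F P) =
      (((S : X →ₗ[ℂ] X).range ⊔ F : Submodule ℂ X) : Set X) ×ˢ Set.univ := by
    ext ⟨y, k⟩
    simp only [Set.mem_range, Set.mem_prod, SetLike.mem_coe, Set.mem_univ, and_true]
    constructor
    · rintro ⟨⟨x, f⟩, h⟩
      have h1 : S x + f = y := congrArg Prod.fst h
      rw [← h1]
      exact Submodule.add_mem_sup ⟨x, rfl⟩ f.2
    · intro h
      obtain ⟨_, ⟨x, rfl⟩, f, hf, rfl⟩ := Submodule.mem_sup.1 h
      have hker : ∀ w : (S : X →ₗ[ℂ] X).ker, S w = 0 := fun w => w.2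
      -- Replacing the kernel component `P x` by `k` leaves `S x` unchanged.
      refine ⟨(x - P x + k, ⟨f, hf⟩), Prod.ext ?_ ?_⟩
      · change S (x - P x + k) + f = S x + f
        rw [map_add, map_sub, hker, hker, sub_zero, add_zero]
      · change P (x - P x + k) = k
        rw [map_add, map_sub, hP, hP, sub_self, zero_add]
  have hclosed : IsClosed (Set.range (borderedL S F P)) := by
    rw [hrange]
    exact (Submodule.isClosed_sup_finiteDimensional _ _ hc).prod isClosed_univ
  filter_upwards [(tendsto_borderedL S F P).eventually (eventually_injective hinj hclosed)]
    with z hz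
  have h := erank_le_of_bordered_injective (coe_borderedL _ F P ▸ hz)
  rw [hF] at h
  exact h

/-- Dual bordering: `F` is a full complement of the range and `P` projects onto `n` dimensions of
the kernel, giving a surjection and the reverse index inequality. -/
theorem IsLowerSemiFredholm.eventually_le {S : X →L[ℂ] X} (hS : IsLowerSemiFredholm S) {n : ℕ}
    (hn : n ≤ alpha S) :
    ∀ᶠ z : ℂ in 𝓝 0, beta (S - z • 1) ≤ beta S ∧
      beta (S - z • 1) + n ≤ alpha (S - z • 1) + beta S := by
  obtain ⟨F, hF⟩ := (S : X →ₗ[ℂ] X).range.exists_isCompl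
  have hβ : beta S = erank ℂ F := erank_eq (Submodule.quotientEquivOfIsCompl _ _ hF)
  have : FiniteDimensional ℂ F := by
    have hfin := hS.2
    rw [hβ, Cardinal.toENat_lt_top] at hfin
    exact Module.rank_lt_aleph0_iff.1 hfin
  obtain ⟨K, hKS, hK, hKfin⟩ := exists_le_erank_eq (S : X →ₗ[ℂ] X).ker hn
  obtain ⟨P, hP⟩ := Submodule.ClosedComplemented.of_finiteDimensional K
  have : CompleteSpace F := FiniteDimensional.complete ℂ F
  have : CompleteSpace K := FiniteDimensional.complete ℂ K
  have hsurj : Function.Surjective (borderedL S F P) := by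
    rintro ⟨y, k⟩
    have hy : y ∈ (S : X →ₗ[ℂ] X).range ⊔ F := hF.sup_eq_top ▸ Submodule.mem_top
    obtain ⟨_, ⟨x, rfl⟩, f, hf, rfl⟩ := Submodule.mem_sup.1 hy
    have hker : ∀ w : K, S w = 0 := fun w => hKS w.2
    refine ⟨(x - P x + k, ⟨f, hf⟩), Prod.ext ?_ ?_⟩
    · change S (x - P x + k) + f = S x + f
      rw [map_add, map_sub, hker, hker, sub_zero, add_zero]
    · change P (x - P x + k) = k
      rw [map_add, map_sub, hP, hP, sub_self, zero_add]
  filter_upwards [(tendsto_borderedL S F P).eventually (eventually_surjective hsurj)] with z hz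
  have h := erank_le_of_bordered_surjective (coe_borderedL _ F P ▸ hz)
  rw [hK] at h
  rw [hβ]
  exact h

theorem IsSemiFredholm.eventually_le {S : X →L[ℂ] X} (hS : IsSemiFredholm S) (n m : ℕ) :
    ∀ᶠ z : ℂ in 𝓝 0,
      (alpha S < ⊤ → n ≤ beta S → alpha (S - z • 1) ≤ alpha S ∧
        alpha (S - z • 1) + n ≤ beta (S - z • 1) + alpha S) ∧
      (beta S < ⊤ → m ≤ alpha S → beta (S - z • 1) ≤ beta S ∧
        beta (S - z • 1) + m ≤ alpha (S - z • 1) + beta S) := by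
  have hc : IsClosed (Set.range S) := hS.elim And.left And.left
  rw [eventually_and, eventually_imp_distrib_left, eventually_imp_distrib_left]
  simp_rw [eventually_imp_distrib_left]
  exact ⟨fun ha hn => IsUpperSemiFredholm.eventually_le ⟨hc, ha⟩ hn,
    fun hb hm => IsLowerSemiFredholm.eventually_le ⟨hc, hb⟩ hm⟩

/-- Here `p` and `q` stand for the nullity and deficiency shared by the two shifted operators. They
may depend on the four test numbers, since the admissible shifts do. -/
theorem sub_eq_sub_of_exists {a b a' b' : ℕ∞} (h : a < ⊤ ∨ b < ⊤) (h' : a' < ⊤ ∨ b' < ⊤)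
    (key : ∀ n m n' m' : ℕ, ∃ p q : ℕ∞,
      ((a < ⊤ → n ≤ b → p ≤ a ∧ p + n ≤ q + a) ∧ (b < ⊤ → m ≤ a → q ≤ b ∧ q + m ≤ p + b)) ∧
      (a' < ⊤ → n' ≤ b' → p ≤ a' ∧ p + n' ≤ q + a') ∧
      (b' < ⊤ → m' ≤ a' → q ≤ b' ∧ q + m' ≤ p + b')) :
    ((a : ENNReal) : EReal) - ((b : ENNReal) : EReal) =
      ((a' : ENNReal) : EReal) - ((b' : ENNReal) : EReal) := by
  obtain ⟨p, q, ⟨h1, h2⟩, h3, h4⟩ := key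
    -- A finite value is tested exactly. For an infinite one, the test number exceeds all finite
    -- data, which rules out a different index on the other side.
    (if b = ⊤ then a.toNat + a'.toNat + b'.toNat + 1 else b.toNat)
    (if a = ⊤ then b.toNat + a'.toNat + b'.toNat + 1 else a.toNat)
    (if b' = ⊤ then a'.toNat + a.toNat + b.toNat + 1 else b'.toNat)
    (if a' = ⊤ then b'.toNat + a.toNat + b.toNat + 1 else a'.toNat)
  clear key
  induction a using ENat.recTopCoe <;> induction b using ENat.recTopCoe <;>
  induction a' using ENat.recTopCoe <;> induction b' using ENat.recTopCoe <;>
  induction p using ENat.recTopCoe <;> induction q using ENat.recTopCoe <;>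
  simp at h h' h1 h2 h3 h4 ⊢ <;> norm_cast at * <;> try omega
  rename_i a b a' b' p q
  have hab : (a : ℝ) - b = a' - b' := by
    rw [sub_eq_sub_iff_add_eq_add]
    exact_mod_cast (by omega : a + b' = a' + b)
  exact congrArg Real.toEReal hab

/-- The nullities and deficiencies of the operators `S - z`, for `z` in any set that accumulates
at `0`, determine the index of a semi-Fredholm operator `S`. -/
theorem index_eq_of_frequently {Y : Type*} [NormedAddCommGroup Y] [NormedSpace ℂ Y]
    [CompleteSpace Y] {S : X →L[ℂ] X} {R : Y →L[ℂ] Y} (hS : IsSemiFredholm S)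
    (hR : IsSemiFredholm R)
    (h : ∃ᶠ z : ℂ in 𝓝 0, alpha (S - z • 1) = alpha (R - z • 1) ∧
      beta (S - z • 1) = beta (R - z • 1)) :
    index S = index R := by
  refine sub_eq_sub_of_exists (hS.imp And.right And.right) (hR.imp And.right And.right)
    fun n m n' m' => ?_
  obtain ⟨z, ⟨ha, hb⟩, h1, h2⟩ :=
    (h.and_eventually ((hS.eventually_le n m).and (hR.eventually_le n' m'))).exists
  rw [← ha, ← hb] at h2
  exact ⟨_, _, h1, h2⟩

end Perturbation

/-! ### Small shifts that are invertible on the zeroloid summands. -/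

section Zeroloid

variable {X Y : Type*} [NormedAddCommGroup X] [NormedSpace ℂ X] [NormedAddCommGroup Y]
  [NormedSpace ℂ Y]

theorem IsZeroloid.eventually_notMem {S : X →L[ℂ] X} (hS : IsZeroloid S) {z : ℂ} (hz : z ≠ 0) :
    ∀ᶠ w in 𝓝[≠] z, w ∉ spectrum ℂ S := by
  have : ¬ AccPt z (𝓟 (spectrum ℂ S)) := fun h => hz (hS h)
  rw [accPt_iff_frequently_nhdsNE] at this
  simpa using this

theorem IsZeroloid.frequently_notMem {S : X →L[ℂ] X} {R : Y →L[ℂ] Y} (hS : IsZeroloid S)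
    (hR : IsZeroloid R) : ∃ᶠ z in 𝓝 (0 : ℂ), z ∉ spectrum ℂ S ∧ z ∉ spectrum ℂ R := by
  rw [frequently_iff]
  intro U hU
  -- Both spectra may accumulate at `0`, so first move to some `z ≠ 0` in the interior of `U`, where
  -- neither does, then perturb `z` off both.
  obtain ⟨z, hzU, hz⟩ := (((eventually_eventually_nhds.2 hU).filter_mono
    (nhdsWithin_le_nhds (s := {0}ᶜ))).and self_mem_nhdsWithin).exists
  obtain ⟨w, hw, h⟩ := ((Eventually.filter_mono (nhdsWithin_le_nhds (s := {z}ᶜ)) hzU).and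
    ((hS.eventually_notMem hz).and (hR.eventually_notMem hz))).exists
  exact ⟨w, hw, h⟩

theorem bijective_sub_smul_of_notMem_spectrum {S : X →L[ℂ] X} {z : ℂ} (hz : z ∉ spectrum ℂ S) :
    Function.Bijective (S - z • 1 : X →L[ℂ] X) := by
  rw [spectrum.notMem_iff, ← IsUnit.neg_iff, neg_sub, Algebra.algebraMap_eq_smul_one] at hz
  obtain ⟨u, hu⟩ := hz
  rw [← hu]
  refine Function.bijective_iff_has_inverse.2 ⟨(u⁻¹ : (X →L[ℂ] X)ˣ), fun x => ?_, fun x => ?_⟩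
  · exact DFunLike.congr_fun u.inv_mul x
  · exact DFunLike.congr_fun u.mul_inv x

/-- Adding to `M` an invariant subspace on which `T - z` is invertible changes neither the nullity
nor the deficiency of `T - z`. -/
theorem alpha_beta_restrict_sup {T : X →L[ℂ] X} {M N : Submodule ℂ X} (hM : Set.MapsTo T M M)
    (hN : Set.MapsTo T N N) (hMN : M ⊓ N = ⊥)
    {W : Submodule ℂ X} (hW : M ⊔ N = W) {z : ℂ} (hz : z ∉ spectrum ℂ (T.restrict hN))
    (hY : ∀ x ∈ W, (T - z • 1) x ∈ W) :
    alpha (T.restrict hM - z • 1) = alpha ((T - z • 1).restrict hY) ∧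
      beta (T.restrict hM - z • 1) = beta ((T - z • 1).restrict hY) := by
  subst hW
  exact erank_restrict_sup (f := ((T - z • 1 : X →L[ℂ] X) : X →ₗ[ℂ] X))
    (fun _ hx => M.sub_mem (hM hx) (M.smul_mem z hx))
    (fun _ hx => N.sub_mem (hN hx) (N.smul_mem z hx)) hMN hY
    (bijective_sub_smul_of_notMem_spectrum hz)

end Zeroloid

end GzFredholm

theorem lemma3p3 {X : Type*} [NormedAddCommGroup X] [NormedSpace ℂ X] [CompleteSpace X]
    (T : X →L[ℂ] X) (M N M' N' : Submodule ℂ X)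
    (hM : IsClosed (M : Set X)) (hN : IsClosed (N : Set X))
    (hM' : IsClosed (M' : Set X)) (hN' : IsClosed (N' : Set X))
    (hTM : Set.MapsTo T M M) (hTN : Set.MapsTo T N N)
    (hTM' : Set.MapsTo T M' M') (hTN' : Set.MapsTo T N' N')
    (hMN : M ⊓ N = ⊥) (hMN' : M' ⊓ N' = ⊥)
    (hsum : M ⊔ N = M' ⊔ N') (hclosed : IsClosed ((M ⊔ N : Submodule ℂ X) : Set X))
    (hFM : GzFredholm.IsSemiFredholm (T.restrict hTM))
    (hFM' : GzFredholm.IsSemiFredholm (T.restrict hTM'))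
    (hZN : GzFredholm.IsZeroloid (T.restrict hTN))
    (hZN' : GzFredholm.IsZeroloid (T.restrict hTN')) :
    GzFredholm.index (T.restrict hTM) = GzFredholm.index (T.restrict hTM') := by
  have := hM.completeSpace_coe
  have := hM'.completeSpace_coe
  refine GzFredholm.index_eq_of_frequently hFM hFM' ((hZN.frequently_notMem hZN').mono ?_)
  rintro z ⟨hz, hz'⟩
  have hY : ∀ x ∈ M ⊔ N, (T - z • 1) x ∈ M ⊔ N := fun x hx => by
    obtain ⟨m, hm, n, hn, rfl⟩ := Submodule.mem_sup.1 hx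
    refine (M ⊔ N).sub_mem ?_ ((M ⊔ N).smul_mem z hx)
    rw [map_add]
    exact Submodule.add_mem_sup (hTM hm) (hTN hn)
  have h := GzFredholm.alpha_beta_restrict_sup hTM hTN hMN rfl hz hY
  have h' := GzFredholm.alpha_beta_restrict_sup hTM' hTN' hMN' hsum.symm hz' hY
  exact ⟨h.1.trans h'.1.symm, h.2.trans h'.2.symm⟩
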